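/- All rings are commutative with $1$. Let $N$ be a commutative monoid (written multiplicatively) that is cancellative and torsion-free ($x^n=y^n$ for some $n\ge 1$ implies $x=y$), let $M\subset N$ be a submonoid, and let $A$ be a ring with $\mathbb Z\subset A$ (i.e. $\mathbb Z\to A$ is injective). An extension of rings $R\subset S$ is called subintegral (resp. weakly subintegral) if $S$ is integral over $R$, the map $\operatorname{Spec} S\to\operatorname{Spec} R$ is bijective, and for every $Q\in\operatorname{Spec} S$ the canonical extension of residue fields $k(Q\cap R)\to k(Q)$ is an isomorphism (resp. purely inseparable). An extension of monoids $M_1\subset M_2$ is called elementary subintegral if $M_2=M_1\cup xM_1$ for some $x\in M_2$ with $x^2,x^3\in M_1$. The extension $M\subset N$ is called subintegral if $N$ is a union of submonoids each of which is obtained from $M$ by a finite succession of elementary subintegral extensions. Then the following are equivalent: 1. the extension of monoid algebras $A[M]\subset A[N]$ is subintegral; 2. the extension of monoid algebras $A[M]\subset A[N]$ is weakly subintegral; 3. the monoid extension $M\subset N$ is subintegral. Moreover, $M\subset N$ is subintegral if and only if for every $z\in N$ one has $z^j\in M$ for all sufficiently large $j$. -/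

import Mathlib

/-! ### Subintegral and weakly subintegral ring extensions

A ring extension `R ⊂ S` is given by an injective ring homomorphism `f : R →+* S`. -/

namespace RingExtension

/-- The canonical homomorphism of residue fields `k(f⁻¹ Q) → k(Q)` at a prime `Q` of `S`,
where `k(P)` is the residue field of the localization at `P`. -/
noncomputable def residueMap {R S : Type*} [CommRing R] [CommRing S] (f : R →+* S)
    (Q : PrimeSpectrum S) :
    (PrimeSpectrum.comap f Q).asIdeal.ResidueField →+* Q.asIdeal.ResidueField :=
  Ideal.ResidueField.map (PrimeSpectrum.comap f Q).asIdeal Q.asIdeal f rfl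

/-- The extension `f : R ⊂ S` is subintegral: `S` is integral over `R`, the map
`Spec S → Spec R` is bijective, and all residue field extensions are isomorphisms. -/
structure IsSubintegral {R S : Type*} [CommRing R] [CommRing S] (f : R →+* S) : Prop where
  injective : Function.Injective f
  isIntegral : f.IsIntegral
  comap_bijective : Function.Bijective (PrimeSpectrum.comap f)
  residueMap_bijective : ∀ Q : PrimeSpectrum S, Function.Bijective (residueMap f Q)

/-- The extension `f : R ⊂ S` is weakly subintegral: `S` is integral over `R`, the map
`Spec S → Spec R` is bijective, and all residue field extensions are purely inseparable. -/
structure IsWeaklySubintegral {R S : Type*} [CommRing R] [CommRing S] (f : R →+* S) :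
    Prop where
  injective : Function.Injective f
  isIntegral : f.IsIntegral
  comap_bijective : Function.Bijective (PrimeSpectrum.comap f)
  residueMap_isPurelyInseparable : ∀ Q : PrimeSpectrum S,
    @IsPurelyInseparable (PrimeSpectrum.comap f Q).asIdeal.ResidueField Q.asIdeal.ResidueField
      _ _ (residueMap f Q).toAlgebra

end RingExtension

/-! ### Subintegral extensions of monoids -/

namespace MonoidExtension

/-- For submonoids `M`, `M'` of `N`: the extension `M ⊂ M'` is elementary subintegral,
i.e. `M' = M ∪ xM` for some `x` with `x ^ 2, x ^ 3 ∈ M`. -/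
def IsElementarySubintegral {N : Type*} [CommMonoid N] (M M' : Submonoid N) : Prop :=
  ∃ x : N, x ^ 2 ∈ M ∧ x ^ 3 ∈ M ∧
    (M' : Set N) = (M : Set N) ∪ (fun m => x * m) '' (M : Set N)

/-- The extension `M ⊂ N` is subintegral: `N` is a union of submonoids, each of which is
obtained from `M` by a finite succession of elementary subintegral extensions. -/
def IsSubintegral {N : Type*} [CommMonoid N] (M : Submonoid N) : Prop :=
  ∃ F : Set (Submonoid N),
    (∀ L ∈ F, Relation.ReflTransGen IsElementarySubintegral M L) ∧
      (⋃ L ∈ F, (L : Set N)) = Set.univ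

end MonoidExtension

/-- The extension of monoid algebras `A[M] ⊂ A[N]` for a submonoid `M` of `N`: the
homomorphism that is the identity on `A` and the inclusion on `M`. -/
noncomputable def monoidAlgebraInclusion (A : Type*) {N : Type*} [CommRing A] [CommMonoid N]
    (M : Submonoid N) : MonoidAlgebra A M →+* MonoidAlgebra A N :=
  MonoidAlgebra.mapDomainRingHom A M.subtype

/-! ### Monoids: subintegrality in terms of large powers. -/

namespace MonoidExtension

variable {N : Type*} [CommMonoid N]

/-! All conditions reduce to: every `z` has all large powers in `M`. Given this, modulo a prime of
`A[N]` the monomial `z` is either zero or the fraction `z ^ (k + 1) / z ^ k` over `A[M]`, so primes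
and residue fields do not change (`isSubintegral_monoidAlgebraInclusion`). Conversely, a weakly
subintegral extension is an epimorphism for maps to fields of characteristic zero. If `z` were not a
quotient of elements of `M` dividing powers of `z`, a character trivial on those elements but not at
`z`, extended by zero, would give two maps on `A[N]` agreeing on `A[M]`. So `m` and `z * m` lie in
`M` with `m * w = z ^ k`; integrality puts some `w ^ l` in `M`, and then two consecutive powers of
`z` lie in `M`, hence all large ones. -/

lemma eventually_pow_mem_of_sq_cube {M : Submonoid N} {z : N}
    (h2 : ∀ᶠ j : ℕ in Filter.atTop, (z ^ 2) ^ j ∈ M)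
    (h3 : ∀ᶠ j : ℕ in Filter.atTop, (z ^ 3) ^ j ∈ M) :
    ∀ᶠ j : ℕ in Filter.atTop, z ^ j ∈ M := by
  obtain ⟨a, ha⟩ := Filter.eventually_atTop.1 h2
  obtain ⟨b, hb⟩ := Filter.eventually_atTop.1 h3
  refine Filter.eventually_atTop.2 ⟨2 * a + 3 * b + 3, fun j hj => ?_⟩
  obtain ⟨u, v, hu, hv, rfl⟩ : ∃ u v, a ≤ u ∧ b ≤ v ∧ j = 2 * u + 3 * v := by
    -- If `j - 3 * b` is odd, one more 3 is used to fix the parity.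
    rcases Nat.even_or_odd' (j - 3 * b) with ⟨c, hc | hc⟩
    · exact ⟨c, b, by omega, le_rfl, by omega⟩
    · exact ⟨c - 1, b + 1, by omega, by omega, by omega⟩
  rw [pow_add, pow_mul, pow_mul]
  exact M.mul_mem (ha u hu) (hb v hv)

lemma eventually_pow_mem_of_pow_succ_mem {M : Submonoid N} {z : N} {n : ℕ}
    (h : z ^ n ∈ M) (h' : z ^ (n + 1) ∈ M) : ∀ᶠ j : ℕ in Filter.atTop, z ^ j ∈ M := by
  refine Filter.eventually_atTop.2 ⟨n * n, fun j hj => ?_⟩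
  rcases Nat.eq_zero_or_pos n with rfl | hn
  · simpa using M.pow_mem h' j
  have hr : j % n ≤ j / n :=
    (Nat.mod_lt j hn).le.trans ((Nat.le_div_iff_mul_le hn).2 hj)
  -- With `j = n * q + r` and `r ≤ q`, turn `r` of the `q` copies of `n` into `n + 1`.
  have hj' : j = n * (j / n - j % n) + (n + 1) * (j % n) := by
    obtain ⟨d, hd⟩ := Nat.exists_eq_add_of_le hr
    have := Nat.div_add_mod j n
    rw [hd] at this ⊢
    rw [Nat.add_sub_cancel_left]
    linarith
  rw [hj', pow_add, pow_mul, pow_mul]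
  exact M.mul_mem (M.pow_mem h _) (M.pow_mem h' _)

lemma eventually_pow_mem_of_reflTransGen {M L : Submonoid N}
    (h : Relation.ReflTransGen IsElementarySubintegral M L) :
    ∀ z ∈ L, ∀ᶠ j : ℕ in Filter.atTop, z ^ j ∈ M := by
  induction h with
  | refl => exact fun z hz => Filter.Eventually.of_forall fun j => M.pow_mem hz j
  | @tail L L' _ hL ih =>
    obtain ⟨x, h2, h3, hL'⟩ := hL
    intro z hz
    rw [← SetLike.mem_coe, hL'] at hz
    rcases hz with hz | ⟨m, hm, rfl⟩
    · exact ih z hz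
    · refine eventually_pow_mem_of_sq_cube (ih _ ?_) (ih _ ?_)
      · simpa only [mul_pow] using L.mul_mem h2 (L.pow_mem hm 2)
      · simpa only [mul_pow] using L.mul_mem h3 (L.pow_mem hm 3)

/-- The submonoid `M ∪ xM`, for `x ^ 2 ∈ M`. -/
def adjoinOfSq (M : Submonoid N) (x : N) (h2 : x ^ 2 ∈ M) : Submonoid N where
  carrier := (M : Set N) ∪ (fun m => x * m) '' (M : Set N)
  one_mem' := Or.inl M.one_mem
  mul_mem' := by
    rintro _ _ (ha | ⟨a, ha, rfl⟩) (hb | ⟨b, hb, rfl⟩)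
    · exact Or.inl (M.mul_mem ha hb)
    · exact Or.inr ⟨_, M.mul_mem ha hb, by simp only [mul_left_comm]⟩
    · exact Or.inr ⟨_, M.mul_mem ha hb, by simp only [mul_assoc]⟩
    · refine Or.inl ?_
      have : x * a * (x * b) = x ^ 2 * (a * b) := by rw [mul_mul_mul_comm, sq]
      simp only [this]
      exact M.mul_mem h2 (M.mul_mem ha hb)

/-- Adjoining the highest power possibly missing, `z ^ (n + 1)`, is an elementary step, since its
square and cube have larger exponents; the bound then drops by one. -/
lemma exists_reflTransGen_of_pow_mem (z : N) (n : ℕ) (M : Submonoid N)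
    (h : ∀ j, n < j → z ^ j ∈ M) :
    ∃ L, Relation.ReflTransGen IsElementarySubintegral M L ∧ z ∈ L := by
  induction n generalizing M with
  | zero => exact ⟨M, .refl, by simpa using h 1 one_pos⟩
  | succ n ih =>
    have h2 : (z ^ (n + 1)) ^ 2 ∈ M := by rw [← pow_mul]; exact h _ (by omega)
    have h3 : (z ^ (n + 1)) ^ 3 ∈ M := by rw [← pow_mul]; exact h _ (by omega)
    obtain ⟨L, hL, hz⟩ := ih (adjoinOfSq M _ h2) fun j hj => by
      rcases (Nat.succ_le_of_lt hj).eq_or_lt with rfl | hj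
      · exact Or.inr ⟨1, M.one_mem, mul_one _⟩
      · exact Or.inl (h j hj)
    exact ⟨L, .head ⟨_, h2, h3, rfl⟩ hL, hz⟩

theorem isSubintegral_iff_eventually_pow_mem (M : Submonoid N) :
    IsSubintegral M ↔ ∀ z : N, ∀ᶠ j : ℕ in Filter.atTop, z ^ j ∈ M := by
  constructor
  · rintro ⟨F, hF, hU⟩ z
    obtain ⟨L, hL, hz⟩ := Set.mem_iUnion₂.1 (hU ▸ Set.mem_univ z)
    exact eventually_pow_mem_of_reflTransGen (hF L hL) z hz
  · intro h
    refine ⟨{L | Relation.ReflTransGen IsElementarySubintegral M L}, fun L hL => hL,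
      Set.eq_univ_of_forall fun z => Set.mem_iUnion₂.2 ?_⟩
    obtain ⟨n, hn⟩ := Filter.eventually_atTop.1 (h z)
    obtain ⟨L, hL, hz⟩ := exists_reflTransGen_of_pow_mem z n M fun j hj => hn j hj.le
    exact ⟨L, hL, hz⟩

end MonoidExtension

/-! ### Ring extensions: a subintegrality criterion and an epimorphism property. -/

namespace RingExtension

section

variable {R S : Type*} [CommRing R] [CommRing S] {f : R →+* S}

lemma residueMap_algebraMap (f : R →+* S) (Q : PrimeSpectrum S) (r : R) :
    residueMap f Q (algebraMap R _ r) = algebraMap S _ (f r) :=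
  Ideal.ResidueField.map_algebraMap _ _ _ _ _

theorem IsSubintegral.isWeaklySubintegral (h : IsSubintegral f) : IsWeaklySubintegral f where
  injective := h.injective
  isIntegral := h.isIntegral
  comap_bijective := h.comap_bijective
  residueMap_isPurelyInseparable Q := by
    let := (residueMap f Q).toAlgebra
    exact (isPurelyInseparable_iff_pow_mem _ (ringExpChar
      (PrimeSpectrum.comap f Q).asIdeal.ResidueField)).2 fun x =>
        ⟨0, (h.residueMap_bijective Q).2 _⟩

lemma residueMap_surjective (Q : PrimeSpectrum S)
    (h : ∀ s : S, ∃ t r : R, f t ∉ Q.asIdeal ∧ f t * s - f r ∈ Q.asIdeal) :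
    Function.Surjective (residueMap f Q) := by
  have key : ∀ s : S, algebraMap S Q.asIdeal.ResidueField s ∈ (residueMap f Q).fieldRange := by
    intro s
    obtain ⟨t, r, ht, hr⟩ := h s
    rw [← Ideal.algebraMap_residueField_eq_zero, map_sub, map_mul, sub_eq_zero] at hr
    rw [← Ideal.algebraMap_residueField_eq_zero] at ht
    refine ⟨algebraMap R _ r / algebraMap R _ t, ?_⟩
    rw [map_div₀, residueMap_algebraMap, residueMap_algebraMap, ← hr, mul_div_cancel_left₀ _ ht]
  intro x
  obtain ⟨a, b, -, rfl⟩ := IsFractionRing.div_surjective (A := S ⧸ Q.asIdeal) x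
  obtain ⟨a, rfl⟩ := Ideal.Quotient.mk_surjective a
  obtain ⟨b, rfl⟩ := Ideal.Quotient.mk_surjective b
  exact div_mem (key a) (key b)

/-- An integral extension is subintegral as soon as every element of `S` is, simultaneously modulo
any two primes over the same prime `P` of `R`, a fraction of elements of `R` with denominator
outside `P`. -/
theorem IsSubintegral.of_exists_mul_sub_mem (hinj : Function.Injective f) (hint : f.IsIntegral)
    (h : ∀ Q Q' : PrimeSpectrum S, PrimeSpectrum.comap f Q = PrimeSpectrum.comap f Q' → ∀ s : S,
      ∃ t r : R, f t ∉ Q.asIdeal ∧ f t * s - f r ∈ Q.asIdeal ∧ f t * s - f r ∈ Q'.asIdeal) :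
    IsSubintegral f where
  injective := hinj
  isIntegral := hint
  comap_bijective := by
    have mem_iff : ∀ {Q Q' : PrimeSpectrum S},
        PrimeSpectrum.comap f Q = PrimeSpectrum.comap f Q' → ∀ r,
        f r ∈ Q.asIdeal ↔ f r ∈ Q'.asIdeal := fun hQ r =>
      SetLike.ext_iff.1 (PrimeSpectrum.ext_iff.1 hQ) r
    have le : ∀ Q Q' : PrimeSpectrum S,
        PrimeSpectrum.comap f Q = PrimeSpectrum.comap f Q' → Q.asIdeal ≤ Q'.asIdeal := by
      intro Q Q' hQ s hs
      obtain ⟨t, r, ht, hr, hr'⟩ := h Q Q' hQ s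
      have h1 : f r ∈ Q'.asIdeal := (mem_iff hQ r).1 <| by
        simpa using Q.asIdeal.sub_mem (Q.asIdeal.mul_mem_left (f t) hs) hr
      have h2 : f t * s ∈ Q'.asIdeal := by simpa using Q'.asIdeal.add_mem hr' h1
      exact (Q'.2.mem_or_mem h2).resolve_left fun ht' => ht ((mem_iff hQ t).2 ht')
    refine ⟨fun Q Q' hQ => PrimeSpectrum.ext (le_antisymm (le _ _ hQ) (le _ _ hQ.symm)), ?_⟩
    exact hint.comap_surjective hinj
  residueMap_bijective Q := ⟨RingHom.injective _, residueMap_surjective Q fun s => by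
    obtain ⟨t, r, ht, hr, -⟩ := h Q Q rfl s
    exact ⟨t, r, ht, hr⟩⟩

/-- A weakly subintegral extension is an epimorphism for homomorphisms to fields of
characteristic zero. -/
theorem IsWeaklySubintegral.ringHom_ext (h : IsWeaklySubintegral f) {L : Type*} [Field L]
    [CharZero L] {g g' : S →+* L} (hg : g.comp f = g'.comp f) : g = g' := by
  have hker : RingHom.ker g = RingHom.ker g' := by
    have := h.comap_bijective.1 (a₁ := ⟨RingHom.ker g, RingHom.ker_isPrime g⟩)
      (a₂ := ⟨RingHom.ker g', RingHom.ker_isPrime g'⟩) (PrimeSpectrum.ext ?_)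
    · exact congrArg PrimeSpectrum.asIdeal this
    · ext r
      exact (congrArg (· = 0) (RingHom.congr_fun hg r)).to_iff
  obtain ⟨Q, hQ⟩ : ∃ Q : PrimeSpectrum S, Q.asIdeal = RingHom.ker g :=
    ⟨⟨RingHom.ker g, RingHom.ker_isPrime g⟩, rfl⟩
  have : CharZero Q.asIdeal.ResidueField := by
    refine charZero_of_inj_zero fun n hn => ?_
    rw [← map_natCast (algebraMap S Q.asIdeal.ResidueField),
      Ideal.algebraMap_residueField_eq_zero, hQ] at hn
    exact Nat.cast_eq_zero.1 ((map_natCast g n).symm.trans hn)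
  have : CharZero (PrimeSpectrum.comap f Q).asIdeal.ResidueField :=
    (residueMap f Q).charZero_iff (RingHom.injective _) |>.2 inferInstance
  let := (residueMap f Q).toAlgebra
  have := h.residueMap_isPurelyInseparable Q
  ext s
  -- In characteristic zero purely inseparable means trivial, so `s` is a fraction from `R` modulo
  -- the common kernel.
  obtain ⟨x, hx⟩ := IsPurelyInseparable.surjective_algebraMap_of_isSeparable
    (PrimeSpectrum.comap f Q).asIdeal.ResidueField Q.asIdeal.ResidueField (algebraMap S _ s)
  change residueMap f Q x = _ at hx
  obtain ⟨a, b, hb, rfl⟩ :=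
    IsFractionRing.div_surjective (A := R ⧸ (PrimeSpectrum.comap f Q).asIdeal) x
  obtain ⟨a, rfl⟩ := Ideal.Quotient.mk_surjective a
  obtain ⟨b, rfl⟩ := Ideal.Quotient.mk_surjective b
  have hb : f b ∉ Q.asIdeal := fun hb' => nonZeroDivisors.ne_zero hb
    (Ideal.Quotient.eq_zero_iff_mem.2 hb')
  rw [map_div₀, Ideal.algebraMap_quotient_residueField_mk,
    Ideal.algebraMap_quotient_residueField_mk, residueMap_algebraMap, residueMap_algebraMap,
    div_eq_iff (Ideal.algebraMap_residueField_eq_zero.not.2 hb), ← map_mul, ← sub_eq_zero,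
    ← map_sub, Ideal.algebraMap_residueField_eq_zero, hQ] at hx
  have e : g (f a) = g s * g (f b) := by
    rw [← map_mul, ← sub_eq_zero, ← map_sub]; exact hx
  have e' : g' (f a) = g' s * g' (f b) := by
    rw [← map_mul, ← sub_eq_zero, ← map_sub]; exact hker.le hx
  have hfa : g (f a) = g' (f a) := RingHom.congr_fun hg a
  have hfb : g (f b) = g' (f b) := RingHom.congr_fun hg b
  exact mul_right_cancel₀ (b := g (f b)) (fun h0 => hb (hQ.ge h0)) (by rw [← e, hfa, e', hfb])

end

end RingExtension

universe u

/-! ### Complex characters and faces. -/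

section Characters

/-- Characters to `ℚ/ℤ` separate points, and `q ↦ exp (2πiq)` embeds `ℚ/ℤ` in the circle. -/
lemma CommGroup.exists_monoidHom_complex_apply_ne_one {G : Type*} [CommGroup G] {a : G}
    (ha : a ≠ 1) : ∃ χ : G →* ℂ, χ a ≠ 1 := by
  obtain ⟨c, hc⟩ := CharacterModule.exists_character_apply_ne_zero_of_ne_zero
    (A := Additive G) (a := Additive.ofMul a) ha
  let e : ℚ →+ Additive Circle :=
    { toFun := fun q => Additive.ofMul (Circle.exp (q * (2 * Real.pi)))
      map_zero' := by simp
      map_add' := fun p q => by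
        rw [← ofMul_mul, ← Circle.exp_add]; push_cast; rw [add_mul] }
  have he : ∀ q : ℚ, e q = 0 ↔ q ∈ AddSubgroup.zmultiples (1 : ℚ) := by
    intro q
    change Circle.exp (q * (2 * Real.pi)) = 1 ↔ _
    rw [Circle.exp_eq_one, AddSubgroup.mem_zmultiples_iff]
    refine exists_congr fun n => ?_
    rw [mul_left_inj' Real.two_pi_pos.ne', zsmul_one]
    exact ⟨fun h => by exact_mod_cast h.symm, fun h => by exact_mod_cast h.symm⟩
  let e' : AddCircle (1 : ℚ) →+ Additive Circle :=
    QuotientAddGroup.lift _ e fun q hq => (he q).2 hq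
  refine ⟨Circle.coeHom.comp (AddMonoidHom.toMultiplicative (e'.comp c)), fun h => hc ?_⟩
  have h : e' (c (Additive.ofMul a)) = 0 := Circle.coe_injective h
  generalize c (Additive.ofMul a) = y at h
  induction y using QuotientAddGroup.induction_on with
  | H q => exact (QuotientAddGroup.eq_zero_iff q).2 ((he q).1 h)

/-- A ring of characteristic zero and `ℂ` map to a common field. -/
lemma exists_field_algebra_and_complex_ringHom (A : Type u) [CommRing A] [CharZero A] :
    ∃ (L : Type u) (_ : Field L), Nonempty (A →+* L) ∧ Nonempty (ℂ →+* L) := by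
  have hinj : Function.Injective
      (Algebra.TensorProduct.includeRight : ℂ →ₐ[ℤ] TensorProduct ℤ A ℂ) :=
    -- `ℂ` is flat over `ℤ`, so tensoring keeps `ℤ → A` injective.
    Algebra.TensorProduct.includeRight_injective (Int.cast_injective (α := A))
  have : Nontrivial (TensorProduct ℤ A ℂ) := hinj.nontrivial
  obtain ⟨m, hm⟩ := Ideal.exists_maximal (TensorProduct ℤ A ℂ)
  exact ⟨_, Ideal.Quotient.field m,
    ⟨(Ideal.Quotient.mk m).comp Algebra.TensorProduct.includeLeftRingHom⟩,
    ⟨(Ideal.Quotient.mk m).comp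
      (Algebra.TensorProduct.includeRight : ℂ →ₐ[ℤ] TensorProduct ℤ A ℂ).toRingHom⟩⟩

variable {N : Type*} [CommMonoid N]

/-- The face of `N` generated by `z`: the divisors of the powers of `z`. -/
def Submonoid.face (z : N) : Submonoid N where
  carrier := {x | ∃ k : ℕ, x ∣ z ^ k}
  one_mem' := ⟨0, one_dvd _⟩
  mul_mem' := by
    rintro x y ⟨k, hk⟩ ⟨l, hl⟩
    exact ⟨k + l, by rw [pow_add]; exact mul_dvd_mul hk hl⟩

namespace Submonoid

lemma self_mem_face (z : N) : z ∈ face z := ⟨1, by simp⟩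

lemma mul_mem_face_iff {z x y : N} : x * y ∈ face z ↔ x ∈ face z ∧ y ∈ face z :=
  ⟨fun ⟨k, hk⟩ => ⟨⟨k, (dvd_mul_right x y).trans hk⟩, ⟨k, (dvd_mul_left y x).trans hk⟩⟩,
    fun h => (face z).mul_mem h.1 h.2⟩

open Classical in
/-- The extension by zero of a character from the face generated by `z`. -/
noncomputable def extendByZero {L : Type*} [MonoidWithZero L] (z : N) (χ : N →* L) : N →* L where
  toFun x := if x ∈ face z then χ x else 0
  map_one' := by rw [if_pos (face z).one_mem, map_one]
  map_mul' x y := by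
    by_cases hx : x ∈ face z <;> by_cases hy : y ∈ face z <;> simp [mul_mem_face_iff, hx, hy]

open Algebra in
/-- If an element of `N` is not a quotient of elements of the submonoid `H`, some complex character
of `N` that is trivial on `H` is not trivial on it. -/
lemma exists_monoidHom_complex_apply_ne_one [IsCancelMul N] (H : Submonoid N) {z : N}
    (hz : ∀ m ∈ H, z * m ∉ H) :
    ∃ χ : N →* ℂ, (∀ m ∈ H, χ m = 1) ∧ χ z ≠ 1 := by
  -- The group of quotients of `H`; the hypothesis says that `z` is outside it.
  let D : Subgroup (GrothendieckGroup N) :=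
    { carrier := {g | ∃ m ∈ H, ∃ m' ∈ H,
        g * GrothendieckGroup.of m = GrothendieckGroup.of m'}
      one_mem' := ⟨1, H.one_mem, 1, H.one_mem, by simp⟩
      mul_mem' := by
        rintro g h ⟨a, ha, a', ha', e⟩ ⟨b, hb, b', hb', e'⟩
        exact ⟨a * b, H.mul_mem ha hb, a' * b', H.mul_mem ha' hb', by
          rw [map_mul, map_mul, mul_mul_mul_comm, e, e']⟩
      inv_mem' := by
        rintro g ⟨a, ha, a', ha', e⟩
        exact ⟨a', ha', a, ha, by rw [← e, inv_mul_cancel_left]⟩ }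
  have hzD : (QuotientGroup.mk (GrothendieckGroup.of z) : GrothendieckGroup N ⧸ D) ≠ 1 := by
    rw [Ne, QuotientGroup.eq_one_iff]
    rintro ⟨m, hm, m', hm', e⟩
    rw [← map_mul] at e
    exact hz m hm (GrothendieckGroup.of_injective e ▸ hm')
  obtain ⟨χ, hχ⟩ := CommGroup.exists_monoidHom_complex_apply_ne_one hzD
  refine ⟨(χ.comp (QuotientGroup.mk' D)).comp GrothendieckGroup.of, fun m hm => ?_, hχ⟩
  have : (QuotientGroup.mk (GrothendieckGroup.of m) : GrothendieckGroup N ⧸ D) = 1 :=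
    (QuotientGroup.eq_one_iff _).2 ⟨1, H.one_mem, m, hm, by simp⟩
  change χ (QuotientGroup.mk _) = 1
  rw [this, map_one]

end Submonoid

end Characters

/-! ### Monoid algebras. -/

section MonoidAlgebra

open MonoidAlgebra

variable {A N : Type*} [CommRing A] [CommMonoid N] {M : Submonoid N}

@[simp]
lemma monoidAlgebraInclusion_single (m : M) (a : A) :
    monoidAlgebraInclusion A M (single m a) = single (m : N) a := by
  simp [monoidAlgebraInclusion]

lemma monoidAlgebraInclusion_injective :
    Function.Injective (monoidAlgebraInclusion A M) :=
  MonoidAlgebra.mapDomain_injective Subtype.val_injective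

lemma coeff_monoidAlgebraInclusion_mul_single {x y : N} (h : ∀ m ∈ M, m * x ≠ y)
    (r : MonoidAlgebra A M) :
    (monoidAlgebraInclusion A M r * single x 1).coeff y = 0 := by
  induction r using MonoidAlgebra.induction_linear with
  | zero => simp
  | add p q hp hq => simp [add_mul, hp, hq]
  | single m a =>
    simp [single_mul_single, h m m.2]

/-- Compare coefficients at `z ^ d` in a monic equation of degree `d`: by cancellation, a lower term
contributes only if some positive power of `z` is in `M`; otherwise `1 = 0`. -/
lemma exists_pow_mem_of_isIntegralElem [IsCancelMul N] [Nontrivial A] {z : N}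
    (hz : (monoidAlgebraInclusion A M).IsIntegralElem (single z 1)) :
    ∃ k, 0 < k ∧ z ^ k ∈ M := by
  by_contra! hM
  obtain ⟨p, hp, hpz⟩ := hz
  have h := congrArg (fun s => s.coeff (z ^ p.natDegree)) hpz
  rw [Polynomial.eval₂_eq_sum_range, Finset.sum_range_succ] at h
  have h0 : ∀ i ∈ Finset.range p.natDegree, (monoidAlgebraInclusion A M (p.coeff i) *
      (single z 1 : MonoidAlgebra A N) ^ i).coeff (z ^ p.natDegree) = 0 := by
    intro i hi
    rw [single_pow, one_pow]
    refine coeff_monoidAlgebraInclusion_mul_single (fun m hm e => ?_) _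
    have hi := Finset.mem_range.1 hi
    rw [← Nat.sub_add_cancel hi.le, pow_add] at e
    exact hM _ (Nat.sub_pos_of_lt hi) (mul_right_cancel e ▸ hm)
  simp only [coeff_add, coeff_sum, Finsupp.add_apply, Finsupp.finsetSum_apply] at h
  rw [Finset.sum_eq_zero h0, hp.coeff_natDegree] at h
  simp [single_pow] at h

lemma isIntegral_monoidAlgebraInclusion (h : ∀ z : N, ∃ k, 0 < k ∧ z ^ k ∈ M) :
    (monoidAlgebraInclusion A M).IsIntegral := by
  intro s
  induction s using MonoidAlgebra.induction_linear with
  | zero => exact RingHom.isIntegralElem_zero _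
  | add p q hp hq => exact hp.add _ hq
  | single z a =>
    obtain ⟨k, hk, hz⟩ := h z
    let := (monoidAlgebraInclusion A M).toAlgebra
    refine IsIntegral.of_pow (R := MonoidAlgebra A M) hk ?_
    rw [single_pow]
    have := (monoidAlgebraInclusion A M).isIntegralElem_map (x := single ⟨z ^ k, hz⟩ (a ^ k))
    rwa [monoidAlgebraInclusion_single] at this

theorem isSubintegral_monoidAlgebraInclusion
    (h : ∀ z : N, ∀ᶠ j : ℕ in Filter.atTop, z ^ j ∈ M) :
    RingExtension.IsSubintegral (monoidAlgebraInclusion A M) := by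
  have h' : ∀ z : N, ∃ k, 0 < k ∧ z ^ k ∈ M ∧ z ^ (k + 1) ∈ M := fun z => by
    obtain ⟨n, hn⟩ := Filter.eventually_atTop.1 (h z)
    exact ⟨n + 1, n.succ_pos, hn _ (by omega), hn _ (by omega)⟩
  refine .of_exists_mul_sub_mem monoidAlgebraInclusion_injective
    (isIntegral_monoidAlgebraInclusion fun z => ?_) fun Q Q' hQ s => ?_
  · obtain ⟨k, hk, hz, -⟩ := h' z
    exact ⟨k, hk, hz⟩
  have mem_iff : ∀ r, monoidAlgebraInclusion A M r ∈ Q.asIdeal ↔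
      monoidAlgebraInclusion A M r ∈ Q'.asIdeal := fun r =>
    SetLike.ext_iff.1 (PrimeSpectrum.ext_iff.1 hQ) r
  induction s using MonoidAlgebra.induction_linear with
  | zero => exact ⟨1, 0, by simpa using (Ideal.ne_top_iff_one _).1 Q.2.ne_top, by simp, by simp⟩
  | add p q hp hq =>
    obtain ⟨t, r, ht, hr, hr'⟩ := hp
    obtain ⟨u, v, hu, hv, hv'⟩ := hq
    have e : monoidAlgebraInclusion A M (t * u) * (p + q) -
        monoidAlgebraInclusion A M (u * r + t * v) =
        monoidAlgebraInclusion A M u * (monoidAlgebraInclusion A M t * p -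
          monoidAlgebraInclusion A M r) + monoidAlgebraInclusion A M t *
          (monoidAlgebraInclusion A M u * q - monoidAlgebraInclusion A M v) := by
      simp only [map_mul, map_add]; ring
    refine ⟨t * u, u * r + t * v, ?_, ?_, ?_⟩
    · rw [map_mul]
      exact fun hm => (Q.2.mem_or_mem hm).elim ht hu
    · rw [e]
      exact add_mem (Ideal.mul_mem_left _ _ hr) (Ideal.mul_mem_left _ _ hv)
    · rw [e]
      exact add_mem (Ideal.mul_mem_left _ _ hr') (Ideal.mul_mem_left _ _ hv')
  | single z a =>
    obtain ⟨k, hk, hz, hz'⟩ := h' z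
    have hpow : monoidAlgebraInclusion A M (single ⟨z ^ k, hz⟩ 1) = (single z 1) ^ k := by
      rw [monoidAlgebraInclusion_single, single_pow, one_pow]
    have hza : (single z a : MonoidAlgebra A N) = single 1 a * single z 1 := by
      rw [single_mul_single, one_mul, mul_one]
    by_cases hzQ : (single z 1 : MonoidAlgebra A N) ∈ Q.asIdeal
    · have hzQ' : (single z 1 : MonoidAlgebra A N) ∈ Q'.asIdeal := by
        refine Q'.2.mem_of_pow_mem k ?_
        rw [← hpow, ← mem_iff, hpow]
        exact Ideal.pow_mem_of_mem _ hzQ _ hk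
      refine ⟨1, 0, by simpa using (Ideal.ne_top_iff_one _).1 Q.2.ne_top, ?_, ?_⟩ <;>
        simp only [map_one, one_mul, map_zero, sub_zero, hza]
      · exact Ideal.mul_mem_left _ _ hzQ
      · exact Ideal.mul_mem_left _ _ hzQ'
    · refine ⟨single ⟨z ^ k, hz⟩ 1, single ⟨z ^ (k + 1), hz'⟩ a, ?_, ?_, ?_⟩
      · rw [hpow]
        exact fun hm => hzQ (Q.2.mem_of_pow_mem k hm)
      all_goals simp [single_mul_single, pow_succ]

theorem eventually_pow_mem_of_isWeaklySubintegral [IsCancelMul N] [CharZero A]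
    (h : RingExtension.IsWeaklySubintegral (monoidAlgebraInclusion A M)) (z : N) :
    ∀ᶠ j : ℕ in Filter.atTop, z ^ j ∈ M := by
  have : Nontrivial A := (Nat.cast_injective (R := A)).nontrivial
  -- Intersecting with the face makes `m` divide a power of `z`.
  obtain ⟨m, ⟨hmM, k, w, hw⟩, hzm⟩ :
      ∃ m ∈ M ⊓ Submonoid.face z, z * m ∈ M ⊓ Submonoid.face z := by
    by_contra! hz
    obtain ⟨χ, hχ, hχz⟩ := Submonoid.exists_monoidHom_complex_apply_ne_one _ hz
    obtain ⟨L, _, ⟨i⟩, ⟨c⟩⟩ := exists_field_algebra_and_complex_ringHom A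
    have : CharZero L := (c.charZero_iff c.injective).1 inferInstance
    let := i.toAlgebra
    let ψ : N →* L := Submonoid.extendByZero z (c.toMonoidHom.comp χ)
    let ψ' : N →* L := Submonoid.extendByZero z 1
    have hext := h.ringHom_ext (g := (MonoidAlgebra.lift A L N ψ).toRingHom)
      (g' := (MonoidAlgebra.lift A L N ψ').toRingHom) <| by
        refine MonoidAlgebra.ringHom_ext (fun a => ?_) fun x => ?_
        · simp
        · by_cases hx : (x : N) ∈ Submonoid.face z
          · simp [ψ, ψ', Submonoid.extendByZero, hx, hχ x ⟨x.2, hx⟩]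
          · simp [ψ, ψ', Submonoid.extendByZero, hx]
    have hψ : ψ z = ψ' z := by
      simpa using RingHom.congr_fun hext (single z 1)
    have hψ : c (χ z) = 1 := by
      simpa [ψ, ψ', Submonoid.extendByZero, Submonoid.self_mem_face] using hψ
    exact hχz (c.injective (hψ.trans (map_one c).symm))
  obtain ⟨l, hl, hwl⟩ := exists_pow_mem_of_isIntegralElem (h.isIntegral (single w 1))
  have e : (z ^ k) ^ l = m ^ l * w ^ l := by rw [hw, mul_pow]
  refine MonoidExtension.eventually_pow_mem_of_pow_succ_mem (n := k * l) ?_ ?_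
  · rw [pow_mul, e]
    exact M.mul_mem (M.pow_mem hmM l) hwl
  · obtain ⟨l, rfl⟩ := Nat.exists_eq_add_of_lt hl
    rw [zero_add] at *
    have : z ^ (k * (l + 1) + 1) = z * m * m ^ l * w ^ (l + 1) := by
      rw [pow_succ, pow_mul, e, pow_succ m, mul_comm _ z]
      simp only [mul_assoc, mul_left_comm]
    rw [this]
    exact M.mul_mem (M.mul_mem hzm.1 (M.pow_mem hmM l)) hwl

end MonoidAlgebra

theorem theorem3p4 {N : Type*} [CommMonoid N] [IsCancelMul N] [IsMulTorsionFree N]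
    (M : Submonoid N) (A : Type*) [CommRing A] [CharZero A] :
    List.TFAE [
      RingExtension.IsSubintegral (monoidAlgebraInclusion A M),
      RingExtension.IsWeaklySubintegral (monoidAlgebraInclusion A M),
      MonoidExtension.IsSubintegral M] ∧
    (MonoidExtension.IsSubintegral M ↔ ∀ z : N, ∀ᶠ j : ℕ in Filter.atTop, z ^ j ∈ M) := by
  have key := MonoidExtension.isSubintegral_iff_eventually_pow_mem M
  refine ⟨?_, key⟩
  tfae_have 1 → 2 := fun h => h.isWeaklySubintegral
  tfae_have 2 → 3 := fun h => key.2 (eventually_pow_mem_of_isWeaklySubintegral h)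
  tfae_have 3 → 1 := fun h => isSubintegral_monoidAlgebraInclusion (key.1 h)
  tfae_finish
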